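/- Let $(\mathbb{k},\mathbb{K})$ be one of the pairs $(\mathbb{R},\mathbb{R})$, $(\mathbb{C},\mathbb{C})$, $(\mathbb{R},\mathbb{C})$. Let $d,n,\ell\ge 0$ be integers with $\ell<d$, let $A$ be a $d\times(d+n)$ matrix with entries in $\mathbb{K}$, and let $p(x)=\det(x-AA^*)$. Let $U$ be a random $\ell\times d$ matrix and let $O$ be a random $(d+n)\times(\ell+n)$ matrix, both with entries in $\mathbb{k}$ and independent of each other, such that $U$ is uniformly distributed on the matrices with orthonormal rows and $O$ is uniformly distributed on the matrices with orthonormal columns; that is, $U$ has the law of the first $\ell$ rows of a Haar distributed $d\times d$ matrix, and $O$ the law of the first $\ell+n$ columns of a Haar distributed $(d+n)\times(d+n)$ matrix, in the orthogonal group if $\mathbb{k}=\mathbb{R}$ and in the unitary group if $\mathbb{k}=\mathbb{C}$. Let $M_n=xD^2+(n+1)D$, where $D=\frac{d}{dx}$. Then, for every $x\in\mathbb{K}$, the random variable $\det\left(x-(UAO)(UAO)^*\right)$ is integrable and $$\mathbb{E}\det\left(x-(UAO)(UAO)^*\right)=\frac{\ell!\,(\ell+n)!}{d!\,(d+n)!}\,\left(M_n^{d-\ell}p\right)(x).$$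 -/

import Mathlib

open MeasureTheory ProbabilityTheory Polynomial
open scoped Matrix

namespace RectCompression

/-- Matrices carry the entrywise (product) measurable structure. -/
instance instMeasurableSpaceMatrix {m n α : Type*} [MeasurableSpace α] :
    MeasurableSpace (Matrix m n α) :=
  inferInstanceAs (MeasurableSpace (m → n → α))

instance instBorelSpaceMatrix {m n α : Type*} [Countable m] [Countable n]
    [MeasurableSpace α] [TopologicalSpace α] [SecondCountableTopology α] [BorelSpace α] :
    BorelSpace (Matrix m n α) :=
  inferInstanceAs (BorelSpace (m → n → α))

/-- The unitary group `U(d)` over `𝕜` (the orthogonal group `O(d)` if `𝕜 = ℝ`) is compact. -/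
instance instCompactSpaceUnitaryGroup (𝕜 : Type*) [RCLike 𝕜] (d : ℕ) :
    CompactSpace (Matrix.unitaryGroup (Fin d) 𝕜) := by
  have hK : IsCompact (Set.univ.pi fun _ : Fin d => Set.univ.pi fun _ : Fin d =>
      Metric.closedBall (0 : 𝕜) 1) :=
    isCompact_univ_pi fun _ => isCompact_univ_pi fun _ => isCompact_closedBall _ _
  have hcl : IsClosed {V : Matrix (Fin d) (Fin d) 𝕜 | V * star V = 1} :=
    isClosed_eq (by fun_prop) continuous_const
  have hset : ((Matrix.unitaryGroup (Fin d) 𝕜 : Set (Matrix (Fin d) (Fin d) 𝕜)))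
      = {V | V * star V = 1} := by
    ext V
    exact Matrix.mem_unitaryGroup_iff
  have hc : IsCompact (Matrix.unitaryGroup (Fin d) 𝕜 : Set (Matrix (Fin d) (Fin d) 𝕜)) := by
    refine IsCompact.of_isClosed_subset (X := Matrix (Fin d) (Fin d) 𝕜) hK (hset ▸ hcl) ?_
    intro V hV i _ j _
    simpa using entry_norm_bound_of_unitary hV i j
  exact isCompact_iff_compactSpace.mp hc

/-- The Haar probability measure on the unitary group `U(d)` over `𝕜`
(on the orthogonal group `O(d)` if `𝕜 = ℝ`): the Haar measure of total mass one. -/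
noncomputable def haarUnitary (𝕜 : Type*) [RCLike 𝕜] [MeasurableSpace 𝕜] [BorelSpace 𝕜] (d : ℕ) :
    Measure (Matrix.unitaryGroup (Fin d) 𝕜) :=
  Measure.haarMeasure ⊤

/-- The uniform distribution on the `ℓ × d` matrices over `𝕜` with orthonormal rows:
the law of the first `ℓ` rows of a Haar distributed `d × d` unitary matrix. -/
noncomputable def uniformOrthonormalRows (𝕜 : Type*) [RCLike 𝕜] [MeasurableSpace 𝕜] [BorelSpace 𝕜]
    {ℓ d : ℕ} (h : ℓ ≤ d) : Measure (Matrix (Fin ℓ) (Fin d) 𝕜) :=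
  (haarUnitary 𝕜 d).map
    fun V : Matrix.unitaryGroup (Fin d) 𝕜 => V.1.submatrix (Fin.castLE h) id

/-- The uniform distribution on the `d × ℓ` matrices over `𝕜` with orthonormal columns:
the law of the first `ℓ` columns of a Haar distributed `d × d` unitary matrix. -/
noncomputable def uniformOrthonormalColumns (𝕜 : Type*) [RCLike 𝕜] [MeasurableSpace 𝕜]
    [BorelSpace 𝕜] {ℓ d : ℕ} (h : ℓ ≤ d) : Measure (Matrix (Fin d) (Fin ℓ) 𝕜) :=
  (haarUnitary 𝕜 d).map
    fun V : Matrix.unitaryGroup (Fin d) 𝕜 => V.1.submatrix id (Fin.castLE h)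

/-- The differential operator `M_a = x D² + (a + 1) D` on polynomials. -/
noncomputable def rectDerivative {R : Type*} [CommRing R] (a : R) : R[X] →ₗ[R] R[X] :=
  LinearMap.mulLeft R X ∘ₗ derivative ∘ₗ derivative + (a + 1) • derivative

end RectCompression

/-! Up to sign, the coefficients of a characteristic polynomial are the sums of principal minors,
and by Cauchy-Binet those of `M * Mᴴ` are sums of the squared moduli of the minors of `M`. Applied
to `U * A * O`, Cauchy-Binet gives a quadruple sum over minors of `U`, `A` and `O`. Under Haar
measure distinct maximal minors of k orthonormal rows or columns are uncorrelated and share the same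
second moment (`integral_minor_mul_star_minor`), so by independence only the squared moduli of the
minors of `A` survive. The k-th minor sum of `A * Aᴴ` is thus multiplied in expectation by
C(ℓ,k)C(ℓ+n,k) / (C(d,k)C(d+n,k)) (`integral_sumMinors_compression`). The operator sends x^m to
m(m+n)x^(m-1); its iterates on monomials produce the same ratio, up to the factorial prefactor
(`smul_rectDerivative_pow_charpoly`). -/

namespace RectCompression

/-! ### Minors and characteristic polynomials -/

/-- The Cauchy-Binet formula. -/
theorem det_mul_eq_sum_minors {R ι : Type*} [CommRing R] [Fintype ι] [LinearOrder ι] {k : ℕ}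
    (A : Matrix (Fin k) ι R) (B : Matrix ι (Fin k) R) :
    (A * B).det = ∑ I : Fin k ↪o ι, (A.submatrix id I).det * (B.submatrix I id).det := by
  have h1 : (A * B).det = ∑ f : Fin k → ι, (∏ i, A i (f i)) * (B.submatrix f id).det := by
    have h := (Matrix.detRowAlternating (R := R) (n := Fin k)).toMultilinearMap.map_sum
      (fun i (j : ι) => A i j • B j)
    have h2 : (fun i => ∑ j, A i j • B j) = A * B := by
      ext i j
      simp [Matrix.mul_apply]
    rw [h2] at h
    refine h.trans (Finset.sum_congr rfl fun f _ => ?_)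
    exact MultilinearMap.map_smul_univ _ _ _
  rw [h1]
  -- An injective map from `Fin k` is uniquely an increasing map after a permutation: the range
  -- determines the former. The permutations rebuild the minor of `A`.
  have hinj : Function.Injective
      (fun p : (Fin k ↪o ι) × Equiv.Perm (Fin k) => (p.1 ∘ p.2 : Fin k → ι)) := by
    rintro ⟨I, σ⟩ ⟨J, τ⟩ h
    have hr : Set.range I = Set.range J := by
      have := congrArg Set.range h
      simpa [Set.range_comp] using this
    have hIJ : I = J := by
      exact DFunLike.coe_injective ((StrictMono.range_inj I.strictMono J.strictMono).1 hr)
    subst hIJ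
    have : σ = τ := Equiv.ext fun i => I.injective (congrFun h i)
    rw [this]
  rw [← Fintype.sum_of_injective _ hinj
    (fun p => (∏ i, A i (p.1 (p.2 i))) * (B.submatrix (p.1 ∘ p.2) id).det) _ ?_ (fun _ => rfl),
    Fintype.sum_prod_type]
  · refine Finset.sum_congr rfl fun I _ => ?_
    rw [← Matrix.det_transpose (A.submatrix id I), Matrix.det_apply', Finset.sum_mul]
    refine Finset.sum_congr rfl fun σ _ => ?_
    have : (B.submatrix (I ∘ σ) id) = (B.submatrix I id).submatrix σ id := rfl
    rw [this, Matrix.det_permute]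
    simp only [Matrix.transpose_apply, Matrix.submatrix_apply, id]
    ring
  · intro f hf
    have hf' : ¬ Function.Injective f := by
      intro hi
      apply hf
      refine ⟨⟨OrderEmbedding.ofStrictMono (f ∘ Tuple.sort f)
        ((Tuple.monotone_sort f).strictMono_of_injective (hi.comp (Equiv.injective _))),
        (Tuple.sort f)⁻¹⟩, ?_⟩
      ext i
      simp
    obtain ⟨i, j, hij, hne⟩ : ∃ i j, f i = f j ∧ i ≠ j := by
      simpa [Function.Injective] using hf'
    rw [Matrix.det_zero_of_row_eq hne (by ext; simp [hij]), mul_zero]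

/-- The sum of the principal minors of order `k`. -/
noncomputable def sumMinors {R : Type*} [CommRing R] {m : ℕ} (k : ℕ)
    (M : Matrix (Fin m) (Fin m) R) : R :=
  ∑ I : Fin k ↪o Fin m, (M.submatrix I I).det

theorem charpoly_eq_sum_sumMinors {R : Type*} [CommRing R] {m : ℕ}
    (M : Matrix (Fin m) (Fin m) R) :
    M.charpoly = ∑ k ∈ Finset.range (m + 1), C ((-1) ^ k * sumMinors k M) * X ^ (m - k) := by
  nontriviality R
  have hco : ∀ k ≤ m, M.charpoly.coeff (m - k) = (-1) ^ k * sumMinors k M := by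
    intro k hk
    have h := M.charpoly_coeff_eq_sum_minors k (by simpa using hk)
    rw [Fintype.card_fin] at h
    rw [h, sumMinors]
    congr 1
    rw [← Finset.sum_coe_sort,
      ← Equiv.sum_comp (Set.powersetCard.ofFinEmbEquiv (I := Fin m) (n := k)).symm]
    refine Fintype.sum_equiv ?_ _ _ ?_
    · exact Equiv.subtypeEquivRight fun s => by simp [Set.powersetCard]
    · intro s
      have hs : s.1.card = k := (Finset.mem_powersetCard.1 s.2).2
      rw [← Matrix.det_submatrix_equiv_self (s.1.orderIsoOfFin hs).toEquiv]
      rfl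
  conv_lhs => rw [M.charpoly.as_sum_range_C_mul_X_pow]
  rw [M.charpoly_natDegree_eq_dim, Fintype.card_fin, ← Finset.sum_range_reflect]
  refine Finset.sum_congr rfl fun k hk => ?_
  have hk' : k ≤ m := by simpa [Nat.lt_succ_iff] using hk
  rw [show m + 1 - 1 - k = m - k by lia, hco k hk']

theorem det_scalar_sub_eq_sum_sumMinors {R : Type*} [CommRing R] {m : ℕ}
    (M : Matrix (Fin m) (Fin m) R) (x : R) :
    (Matrix.scalar (Fin m) x - M).det =
      ∑ k ∈ Finset.range (m + 1), (-1) ^ k * sumMinors k M * x ^ (m - k) := by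
  rw [← Matrix.eval_charpoly, charpoly_eq_sum_sumMinors, eval_finsetSum]
  simp

theorem continuous_sumMinors {R : Type*} [CommRing R] [TopologicalSpace R] [IsTopologicalRing R]
    {m : ℕ} (k : ℕ) : Continuous (sumMinors k : Matrix (Fin m) (Fin m) R → R) := by
  unfold sumMinors
  fun_prop

theorem sumMinors_mul_conjTranspose {R : Type*} [CommRing R] [StarRing R] {a b : ℕ} (k : ℕ)
    (M : Matrix (Fin a) (Fin b) R) :
    sumMinors k (M * Mᴴ) = ∑ S : Fin k ↪o Fin a, ∑ T : Fin k ↪o Fin b,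
      (M.submatrix S T).det * star (M.submatrix S T).det := by
  refine Finset.sum_congr rfl fun S _ => ?_
  have : (M * Mᴴ).submatrix S S = M.submatrix S id * (M.submatrix S id)ᴴ := by
    ext i j
    simp [Matrix.mul_apply]
  rw [this, det_mul_eq_sum_minors]
  refine Finset.sum_congr rfl fun T _ => ?_
  rw [← Matrix.det_conjTranspose]
  rfl

theorem minor_mul_mul {R : Type*} [CommRing R] {a b c e k : ℕ}
    (U : Matrix (Fin a) (Fin b) R) (A : Matrix (Fin b) (Fin c) R) (O : Matrix (Fin c) (Fin e) R)
    (S : Fin k ↪o Fin a) (T : Fin k ↪o Fin e) :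
    ((U * A * O).submatrix S T).det = ∑ J : Fin k ↪o Fin c, ∑ I : Fin k ↪o Fin b,
      (U.submatrix S I).det * (A.submatrix I J).det * (O.submatrix J T).det := by
  have h1 : (U * A * O).submatrix S T = (U * A).submatrix S id * O.submatrix id T := by
    ext i j
    simp [Matrix.mul_apply]
  have h2 (J : Fin k ↪o Fin c) : ((U * A).submatrix S id).submatrix id J
      = U.submatrix S id * A.submatrix id J := by
    ext i j
    simp [Matrix.mul_apply]
  rw [h1, det_mul_eq_sum_minors]
  refine Finset.sum_congr rfl fun J _ => ?_
  rw [h2, det_mul_eq_sum_minors, Finset.sum_mul]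
  rfl

/-! ### The differential operator on monomials -/

theorem rectDerivative_X_pow {R : Type*} [CommRing R] (a : R) (m : ℕ) :
    rectDerivative a (X ^ m) = C ((m : R) * (m + a)) * X ^ (m - 1) := by
  simp only [rectDerivative, LinearMap.add_apply, LinearMap.comp_apply, LinearMap.smul_apply,
    LinearMap.mulLeft_apply, derivative_X_pow, derivative_C_mul, smul_eq_C_mul]
  rcases m with _ | _ | m
  · simp
  · simp; ring
  · simp only [map_mul, map_add, map_one, map_natCast, Nat.add_sub_cancel]
    push_cast
    ring

theorem rectDerivative_pow_X_pow {K : Type*} [Field K] [CharZero K] (n m j : ℕ) (h : j ≤ m) :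
    (rectDerivative (n : K) ^ j) (X ^ m) =
      C (((m.factorial : K) * (m + n).factorial) / ((m - j).factorial * (m - j + n).factorial))
        * X ^ (m - j) := by
  induction j with
  | zero =>
    have h1 := Nat.cast_ne_zero (R := K).2 m.factorial_ne_zero
    have h2 := Nat.cast_ne_zero (R := K).2 (m + n).factorial_ne_zero
    simp [div_self (mul_ne_zero h1 h2)]
  | succ j ih =>
    obtain ⟨q, rfl⟩ : ∃ q, m = j + 1 + q := ⟨m - (j + 1), by lia⟩
    rw [pow_succ', Module.End.mul_apply, ih (by lia), ← smul_eq_C_mul, map_smul,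
      rectDerivative_X_pow, smul_eq_C_mul, ← mul_assoc, ← C_mul]
    rw [show j + 1 + q - j = q + 1 by lia, show j + 1 + q - (j + 1) = q by lia,
      show q + 1 + n = (q + n) + 1 by lia, Nat.factorial_succ q, Nat.factorial_succ (q + n),
      show q + 1 - 1 = q by lia]
    congr 2
    have h1 := Nat.cast_ne_zero (R := K).2 q.factorial_ne_zero
    have h2 := Nat.cast_ne_zero (R := K).2 (q + n).factorial_ne_zero
    have h3 : ((q : K) + 1) ≠ 0 := by exact_mod_cast (Nat.succ_ne_zero q)
    have h4 : ((q : K) + n + 1) ≠ 0 := by exact_mod_cast (Nat.succ_ne_zero (q + n))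
    push_cast
    field_simp
    ring

/-- After `m` applications a constant is left, and the next one kills it. This removes the minor
sums of order above ℓ. -/
theorem rectDerivative_pow_X_pow_of_lt {K : Type*} [Field K] [CharZero K] (n m j : ℕ) (h : m < j) :
    (rectDerivative (n : K) ^ j) (X ^ m) = 0 := by
  obtain ⟨q, rfl⟩ : ∃ q, j = q + 1 + m := ⟨j - (m + 1), by lia⟩
  rw [pow_add, Module.End.mul_apply, rectDerivative_pow_X_pow n m m le_rfl, pow_succ,
    Module.End.mul_apply, ← smul_eq_C_mul, map_smul, rectDerivative_X_pow]
  simp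

theorem smul_rectDerivative_pow_charpoly {K : Type*} [Field K] [CharZero K] {d n ℓ : ℕ}
    (hℓ : ℓ ≤ d) (M : Matrix (Fin d) (Fin d) K) (x : K) :
    (((ℓ.factorial : K) * ((ℓ + n).factorial : K)) /
        ((d.factorial : K) * ((d + n).factorial : K))) *
      ((rectDerivative (n : K) ^ (d - ℓ)) M.charpoly).eval x =
    ∑ k ∈ Finset.range (ℓ + 1), ((-1) ^ k * (((ℓ.choose k : K) * (ℓ + n).choose k) /
      ((d.choose k : K) * (d + n).choose k) * sumMinors k M)) * x ^ (ℓ - k) := by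
  rw [charpoly_eq_sum_sumMinors, map_sum, eval_finsetSum, Finset.mul_sum,
    ← Finset.sum_subset (Finset.range_mono (Nat.succ_le_succ hℓ))]
  · refine Finset.sum_congr rfl fun k hk => ?_
    have hk' : k ≤ ℓ := by simpa [Nat.lt_succ_iff] using hk
    rw [← smul_eq_C_mul, map_smul, rectDerivative_pow_X_pow n _ _ (by lia),
      show d - k - (d - ℓ) = ℓ - k by lia]
    simp only [smul_eq_C_mul, eval_mul, eval_C, eval_pow, eval_X]
    rw [Nat.cast_choose K hk', Nat.cast_choose K (hk'.trans hℓ),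
      Nat.cast_choose K (show k ≤ ℓ + n by lia), Nat.cast_choose K (show k ≤ d + n by lia),
      show d - k + n = d + n - k by lia, show ℓ - k + n = ℓ + n - k by lia]
    have h (a : ℕ) : (a.factorial : K) ≠ 0 := Nat.cast_ne_zero.2 a.factorial_ne_zero
    have h1 := h ℓ
    have h2 := h d
    have h3 := h k
    have h4 := h (ℓ - k)
    have h5 := h (d - k)
    have h6 := h (ℓ + n)
    have h7 := h (d + n)
    have h8 := h (ℓ + n - k)
    have h9 := h (d + n - k)
    field_simp
  · intro k hk hk'
    have h1 : k ≤ d := by simpa [Nat.lt_succ_iff] using hk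
    have h2 : ℓ < k := by simpa using hk'
    rw [← smul_eq_C_mul, map_smul, rectDerivative_pow_X_pow_of_lt n _ _ (by lia)]
    simp

/-! ### Second moments of minors under Haar measure -/

section Moments

variable {𝕜 𝕂 : Type*} [RCLike 𝕜] [RCLike 𝕂] [NormedAlgebra 𝕜 𝕂]

theorem card_orderEmbedding_fin (k d : ℕ) : Fintype.card (Fin k ↪o Fin d) = d.choose k := by
  rw [Fintype.card_congr (Set.powersetCard.ofFinEmbEquiv (I := Fin d) (n := k)),
    ← Nat.card_eq_fintype_card, Set.powersetCard.card, Nat.card_eq_fintype_card, Fintype.card_fin]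

theorem diagonal_sign_mem_unitaryGroup {d : ℕ} (a : Fin d) :
    Matrix.diagonal (fun j => if j = a then (-1 : 𝕜) else 1) ∈ Matrix.unitaryGroup (Fin d) 𝕜 := by
  rw [Matrix.mem_unitaryGroup_iff, Matrix.star_eq_conjTranspose, Matrix.diagonal_conjTranspose,
    Matrix.diagonal_mul_diagonal, ← Matrix.diagonal_one]
  congr 1
  ext j
  by_cases h : j = a <;> simp [h]

theorem permMatrix_mem_unitaryGroup {d : ℕ} (σ : Equiv.Perm (Fin d)) :
    σ.permMatrix 𝕜 ∈ Matrix.unitaryGroup (Fin d) 𝕜 := by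
  rw [Matrix.mem_unitaryGroup_iff, Matrix.star_eq_conjTranspose, Matrix.conjTranspose_permMatrix,
    ← Matrix.permMatrix_mul, inv_mul_cancel, Matrix.permMatrix_one]

/-- The second moments of the maximal minors of a random matrix with orthonormal rows whose law
is invariant under right multiplication by unitary matrices. -/
theorem integral_minor_mul_star_minor {G : Type*} [MeasurableSpace G] (μ : Measure G)
    [IsProbabilityMeasure μ] {k d : ℕ} (X : G → Matrix (Fin k) (Fin d) 𝕂)
    (hX : ∀ g, X g * (X g)ᴴ = 1)
    (hint : ∀ I : Fin k ↪o Fin d,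
      Integrable (fun g => ((X g).submatrix id I).det * star ((X g).submatrix id I).det) μ)
    (hinv : ∀ Q ∈ Matrix.unitaryGroup (Fin d) 𝕜, ∀ f : Matrix (Fin k) (Fin d) 𝕂 → 𝕂,
      ∫ g, f (X g * Q.map (algebraMap 𝕜 𝕂)) ∂μ = ∫ g, f (X g) ∂μ)
    (I J : Fin k ↪o Fin d) :
    ∫ g, ((X g).submatrix id I).det * star ((X g).submatrix id J).det ∂μ =
      if I = J then ((d.choose k : 𝕂))⁻¹ else 0 := by
  have hperm : ∀ I J : Fin k ↪o Fin d,
      ∫ g, ((X g).submatrix id I).det * star ((X g).submatrix id I).det ∂μ =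
      ∫ g, ((X g).submatrix id J).det * star ((X g).submatrix id J).det ∂μ := by
    intro I J
    obtain ⟨σ, hσ⟩ := (Equiv.Perm.isMultiplyPretransitive (Fin d) k).exists_smul_eq
      I.toEmbedding J.toEmbedding
    have hσ' : ∀ i, σ (I i) = J i := fun i => DFunLike.congr_fun hσ i
    -- Right multiplication by this matrix puts column `σ j` in place `j`, so the minor on `I`
    -- becomes the minor on `J`.
    rw [← hinv _ (permMatrix_mem_unitaryGroup σ⁻¹) (fun N =>
      (N.submatrix id I).det * star (N.submatrix id I).det)]
    have : ∀ g, ((X g * ((σ⁻¹).permMatrix 𝕜).map (algebraMap 𝕜 𝕂)).submatrix id I)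
        = (X g).submatrix id J := by
      intro g
      rw [Equiv.Perm.permMatrix, PEquiv.map_toMatrix, PEquiv.mul_toMatrix_toPEquiv]
      ext i j
      simp [← hσ' j]
      rfl
    simp only [this]
  -- Cauchy-Binet for `X g * (X g)ᴴ = 1` normalises the common value.
  have hsum : ∑ I : Fin k ↪o Fin d,
      ∫ g, ((X g).submatrix id I).det * star ((X g).submatrix id I).det ∂μ = 1 := by
    rw [← integral_finsetSum _ fun I _ => hint I]
    have : ∀ g, ∑ I : Fin k ↪o Fin d,
        ((X g).submatrix id I).det * star ((X g).submatrix id I).det = 1 := by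
      intro g
      have h := det_mul_eq_sum_minors (X g) (X g)ᴴ
      rw [hX g, Matrix.det_one] at h
      rw [h]
      refine Finset.sum_congr rfl fun I _ => ?_
      rw [← Matrix.det_conjTranspose]
      rfl
    simp only [this, integral_const, probReal_univ, one_smul]
  split_ifs with hIJ
  · subst hIJ
    rw [Finset.sum_congr rfl fun J _ => hperm J I, Finset.sum_const, Finset.card_univ,
      card_orderEmbedding_fin, nsmul_eq_mul] at hsum
    exact eq_inv_of_mul_eq_one_right hsum
  -- Flipping the sign of a column used by `I` but not by `J` negates the integrand, so the mixed
  -- moment equals its own negative.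
  · obtain ⟨a, ha, ha'⟩ : ∃ a, a ∈ Set.range I ∧ a ∉ Set.range J := by
      by_contra! h
      apply hIJ
      have hs : Set.range I ⊆ Set.range J := h
      have he : Set.range I = Set.range J := by
        apply Set.eq_of_subset_of_card_le hs
        rw [Set.card_range_of_injective I.injective, Set.card_range_of_injective J.injective]
      exact DFunLike.coe_injective ((StrictMono.range_inj I.strictMono J.strictMono).1 he)
    have hD : ∀ g, ∀ K : Fin k ↪o Fin d,
        ((X g * (Matrix.diagonal (fun j => if j = a then (-1 : 𝕜) else 1)).map
          (algebraMap 𝕜 𝕂)).submatrix id K).det =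
        (∏ i, if K i = a then (-1 : 𝕂) else 1) * ((X g).submatrix id K).det := by
      intro g K
      rw [← Matrix.det_mul_row]
      congr 1
      ext i j
      rw [Matrix.diagonal_map (map_zero _)]
      simp only [Matrix.submatrix_apply, Matrix.mul_diagonal, Matrix.of_apply, id]
      split_ifs <;> simp
    obtain ⟨i₀, rfl⟩ := ha
    have hI : (∏ i, if I i = I i₀ then (-1 : 𝕂) else 1) = -1 := by
      simp [I.injective.eq_iff]
    have hJ : (∏ i, if J i = I i₀ then (-1 : 𝕂) else 1) = 1 :=
      Finset.prod_eq_one fun i _ => if_neg fun h => ha' ⟨i, h⟩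
    have h := hinv _ (diagonal_sign_mem_unitaryGroup (I i₀)) (fun N =>
      (N.submatrix id I).det * star (N.submatrix id J).det)
    simp only [hD, hI, hJ, one_mul, neg_mul, integral_neg] at h
    exact CharZero.neg_eq_self_iff.1 h

variable [MeasurableSpace 𝕜] [BorelSpace 𝕜]

instance instBorelSpaceUnitaryGroup (d : ℕ) : BorelSpace (Matrix.unitaryGroup (Fin d) 𝕜) :=
  Subtype.borelSpace _

instance instSecondCountableTopologyUnitaryGroup (d : ℕ) :
    SecondCountableTopology (Matrix.unitaryGroup (Fin d) 𝕜) :=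
  @TopologicalSpace.Subtype.secondCountableTopology (Matrix (Fin d) (Fin d) 𝕜) _ _
    (inferInstanceAs (SecondCountableTopology (Fin d → Fin d → 𝕜)))

instance instIsHaarMeasureHaarUnitary (d : ℕ) : (haarUnitary 𝕜 d).IsHaarMeasure :=
  Measure.isHaarMeasure_haarMeasure _

instance instIsProbabilityMeasureHaarUnitary (d : ℕ) : IsProbabilityMeasure (haarUnitary 𝕜 d) :=
  ⟨Measure.haarMeasure_self⟩

/-- Compact groups are unimodular: a right translate is again a Haar probability measure, hence the
same one. -/
instance instIsMulRightInvariantHaarUnitary (d : ℕ) :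
    (haarUnitary 𝕜 d).IsMulRightInvariant where
  map_mul_right_eq_self g := by
    have : IsProbabilityMeasure ((haarUnitary 𝕜 d).map (· * g)) :=
      Measure.isProbabilityMeasure_map (by fun_prop)
    exact Measure.isHaarMeasure_eq_of_isProbabilityMeasure _ _

theorem integral_minor_rows_haarUnitary [StarModule 𝕜 𝕂] {k d : ℕ} (S I J : Fin k ↪o Fin d) :
    ∫ V : Matrix.unitaryGroup (Fin d) 𝕜,
      ((V.1.map (algebraMap 𝕜 𝕂)).submatrix S I).det *
        star ((V.1.map (algebraMap 𝕜 𝕂)).submatrix S J).det ∂(haarUnitary 𝕜 d) =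
      if I = J then ((d.choose k : 𝕂))⁻¹ else 0 := by
  have hc : Continuous (algebraMap 𝕜 𝕂) := continuous_algebraMap 𝕜 𝕂
  have hs (r : 𝕜) : algebraMap 𝕜 𝕂 (starRingEnd 𝕜 r) = starRingEnd 𝕂 (algebraMap 𝕜 𝕂 r) :=
    algebraMap_star_comm r
  refine integral_minor_mul_star_minor (𝕜 := 𝕜) (haarUnitary 𝕜 d)
    (fun V => (V.1.map (algebraMap 𝕜 𝕂)).submatrix S id) (fun V => ?_) (fun I => ?_)
    (fun Q hQ f => ?_) I J
  · have h : V.1 * V.1ᴴ = 1 := Matrix.mem_unitaryGroup_iff.1 V.2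
    have h2 := congrArg (fun N => (N.map (algebraMap 𝕜 𝕂)).submatrix S S) h
    ext i j
    have h3 := congrFun (congrFun h2 i) j
    simpa [Matrix.mul_apply, Matrix.one_apply, hs, apply_ite] using h3
  · refine Continuous.integrable_of_hasCompactSupport ?_ (HasCompactSupport.of_compactSpace _)
    fun_prop
  · refine Eq.trans ?_ (integral_mul_right_eq_self (μ := haarUnitary 𝕜 d)
      (fun V => f ((V.1.map (algebraMap 𝕜 𝕂)).submatrix S id)) ⟨Q, hQ⟩)
    congr 1
    ext V
    congr 1
    ext i j
    simp [Matrix.mul_apply]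

theorem integral_minor_columns_haarUnitary [StarModule 𝕜 𝕂] {k d : ℕ} (T I J : Fin k ↪o Fin d) :
    ∫ V : Matrix.unitaryGroup (Fin d) 𝕜,
      ((V.1.map (algebraMap 𝕜 𝕂)).submatrix I T).det *
        star ((V.1.map (algebraMap 𝕜 𝕂)).submatrix J T).det ∂(haarUnitary 𝕜 d) =
      if I = J then ((d.choose k : 𝕂))⁻¹ else 0 := by
  have hc : Continuous (algebraMap 𝕜 𝕂) := continuous_algebraMap 𝕜 𝕂
  have hs (r : 𝕜) : algebraMap 𝕜 𝕂 (starRingEnd 𝕜 r) = starRingEnd 𝕂 (algebraMap 𝕜 𝕂 r) :=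
    algebraMap_star_comm r
  rw [← integral_minor_mul_star_minor (𝕜 := 𝕜) (haarUnitary 𝕜 d)
    (fun V => ((V.1.map (algebraMap 𝕜 𝕂)).submatrix id T)ᵀ) (fun V => ?_) (fun I => ?_)
    (fun Q hQ f => ?_) I J]
  · congr 1
    ext V
    rw [← Matrix.det_transpose, ← Matrix.det_transpose (Matrix.submatrix _ J T)]
    rfl
  · have h : V.1ᴴ * V.1 = 1 := Matrix.mem_unitaryGroup_iff'.1 V.2
    have h2 := congrArg (fun N => (N.map (algebraMap 𝕜 𝕂)).submatrix T T) h
    ext i j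
    have h3 := congrFun (congrFun h2 j) i
    simpa [Matrix.mul_apply, Matrix.one_apply, hs, apply_ite, mul_comm,
      eq_comm] using h3
  · refine Continuous.integrable_of_hasCompactSupport ?_ (HasCompactSupport.of_compactSpace _)
    fun_prop
  -- After transposition, right multiplication by `Q` is left multiplication of `V` by `Qᵀ`.
  · refine Eq.trans ?_ (integral_mul_left_eq_self (μ := haarUnitary 𝕜 d)
      (fun V => f ((V.1.map (algebraMap 𝕜 𝕂)).submatrix id T)ᵀ)
      ⟨Qᵀ, Matrix.transpose_mem_unitaryGroup_iff.2 hQ⟩)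
    congr 1
    ext V
    congr 1
    ext i j
    simp [Matrix.mul_apply, mul_comm]

end Moments

/-! ### Expected minor sums of the compression -/

section Compression

variable {𝕜 𝕂 : Type*} [RCLike 𝕜] [RCLike 𝕂]

/-- The compression `U * A * O` of `A` by a matrix `U` with `a` rows and a matrix `O` with
`e` columns. -/
def compression [NormedAlgebra 𝕜 𝕂] {a b c e : ℕ} (A : Matrix (Fin b) (Fin c) 𝕂)
    (z : Matrix (Fin a) (Fin b) 𝕜 × Matrix (Fin c) (Fin e) 𝕜) : Matrix (Fin a) (Fin e) 𝕂 :=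
  z.1.map (algebraMap 𝕜 𝕂) * A * z.2.map (algebraMap 𝕜 𝕂)

theorem continuous_compression [NormedAlgebra 𝕜 𝕂] {a b c e : ℕ} (A : Matrix (Fin b) (Fin c) 𝕂) :
    Continuous (compression (𝕜 := 𝕜) (a := a) (e := e) A) := by
  have hc : Continuous (algebraMap 𝕜 𝕂) := continuous_algebraMap 𝕜 𝕂
  unfold compression
  fun_prop

/-- The first `a` rows and the first `e` columns of a pair of unitary matrices. -/
def rowsColumns {a b c e : ℕ} (hab : a ≤ b) (hec : e ≤ c)
    (z : Matrix.unitaryGroup (Fin b) 𝕜 × Matrix.unitaryGroup (Fin c) 𝕜) :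
    Matrix (Fin a) (Fin b) 𝕜 × Matrix (Fin c) (Fin e) 𝕜 :=
  (z.1.1.submatrix (Fin.castLE hab) id, z.2.1.submatrix id (Fin.castLE hec))

theorem continuous_rowsColumns {a b c e : ℕ} (hab : a ≤ b) (hec : e ≤ c) :
    Continuous (rowsColumns (𝕜 := 𝕜) hab hec) := by
  unfold rowsColumns
  fun_prop

variable [MeasurableSpace 𝕜] [BorelSpace 𝕜]

theorem integrable_haarUnitary_prod {b c : ℕ}
    {f : Matrix.unitaryGroup (Fin b) 𝕜 × Matrix.unitaryGroup (Fin c) 𝕜 → 𝕂}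
    (hf : Continuous f) : Integrable f ((haarUnitary 𝕜 b).prod (haarUnitary 𝕜 c)) :=
  hf.integrable_of_hasCompactSupport (HasCompactSupport.of_compactSpace _)

/-- Each pair `S`, `T` contributes the same amount, by orthogonality of the minors; the numerator
counts these pairs. -/
theorem integral_sumMinors_compression [NormedAlgebra 𝕜 𝕂] [StarModule 𝕜 𝕂]
    {a b c e : ℕ} (hab : a ≤ b) (hec : e ≤ c)
    (A : Matrix (Fin b) (Fin c) 𝕂) (k : ℕ) :
    ∫ z, sumMinors k (compression A (rowsColumns (𝕜 := 𝕜) hab hec z) *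
        (compression A (rowsColumns (𝕜 := 𝕜) hab hec z))ᴴ)
      ∂((haarUnitary 𝕜 b).prod (haarUnitary 𝕜 c)) =
    ((a.choose k : 𝕂) * e.choose k) / ((b.choose k : 𝕂) * c.choose k) *
      sumMinors k (A * Aᴴ) := by
  have hc : Continuous (algebraMap 𝕜 𝕂) := continuous_algebraMap 𝕜 𝕂
  have hterm : ∀ (S : Fin k ↪o Fin a) (T : Fin k ↪o Fin e),
      ∫ z, ((compression A (rowsColumns (𝕜 := 𝕜) hab hec z)).submatrix S T).det *
        star ((compression A (rowsColumns (𝕜 := 𝕜) hab hec z)).submatrix S T).det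
        ∂((haarUnitary 𝕜 b).prod (haarUnitary 𝕜 c)) =
      ((b.choose k : 𝕂) * c.choose k)⁻¹ * sumMinors k (A * Aᴴ) := by
    intro S T
    let u (I : Fin k ↪o Fin b) (V : Matrix.unitaryGroup (Fin b) 𝕜) : 𝕂 :=
      ((V.1.map (algebraMap 𝕜 𝕂)).submatrix (S.trans (Fin.castLEOrderEmb hab)) I).det
    let o (J : Fin k ↪o Fin c) (W : Matrix.unitaryGroup (Fin c) 𝕜) : 𝕂 :=
      ((W.1.map (algebraMap 𝕜 𝕂)).submatrix J (T.trans (Fin.castLEOrderEmb hec))).det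
    have hu (I) : Continuous (u I) := by fun_prop
    have ho (J) : Continuous (o J) := by fun_prop
    have hexp : ∀ z, ((compression A (rowsColumns (𝕜 := 𝕜) hab hec z)).submatrix S T).det *
        star ((compression A (rowsColumns (𝕜 := 𝕜) hab hec z)).submatrix S T).det =
        ∑ J : Fin k ↪o Fin c, ∑ I : Fin k ↪o Fin b,
          ∑ J' : Fin k ↪o Fin c, ∑ I' : Fin k ↪o Fin b, ((A.submatrix I J).det * star (A.submatrix I' J').det) *
          ((u I z.1 * star (u I' z.1)) * (o J z.2 * star (o J' z.2))) := by
      intro z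
      have : ((compression A (rowsColumns (𝕜 := 𝕜) hab hec z)).submatrix S T).det =
          ∑ J : Fin k ↪o Fin c, ∑ I : Fin k ↪o Fin b, u I z.1 * (A.submatrix I J).det * o J z.2 := minor_mul_mul _ _ _ _ _
      rw [this, star_sum, Finset.sum_mul]
      refine Finset.sum_congr rfl fun J _ => ?_
      rw [Finset.sum_mul]
      refine Finset.sum_congr rfl fun I _ => ?_
      rw [Finset.mul_sum]
      refine Finset.sum_congr rfl fun J' _ => ?_
      rw [star_sum, Finset.mul_sum]
      refine Finset.sum_congr rfl fun I' _ => ?_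
      simp only [star_mul']
      ring
    have hmom : ∀ (I I' : Fin k ↪o Fin b) (J J' : Fin k ↪o Fin c),
        ∫ z, ((A.submatrix I J).det * star (A.submatrix I' J').det) *
          ((u I z.1 * star (u I' z.1)) * (o J z.2 * star (o J' z.2)))
          ∂((haarUnitary 𝕜 b).prod (haarUnitary 𝕜 c)) =
        ((A.submatrix I J).det * star (A.submatrix I' J').det) *
          ((if I = I' then ((b.choose k : 𝕂))⁻¹ else 0) *
            (if J = J' then ((c.choose k : 𝕂))⁻¹ else 0)) := by
      intro I I' J J'
      rw [integral_const_mul, integral_prod_mul (fun V => u I V * star (u I' V))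
        (fun W => o J W * star (o J' W)), integral_minor_rows_haarUnitary,
        integral_minor_columns_haarUnitary]
    simp only [hexp]
    have hsum : ∀ f : (Fin k ↪o Fin c) → (Fin k ↪o Fin b) → (Fin k ↪o Fin c) → (Fin k ↪o Fin b) →
          Matrix.unitaryGroup (Fin b) 𝕜 × Matrix.unitaryGroup (Fin c) 𝕜 → 𝕂,
        (∀ J I J' I', Continuous (f J I J' I')) →
        ∫ z, ∑ J, ∑ I, ∑ J', ∑ I', f J I J' I' z ∂((haarUnitary 𝕜 b).prod (haarUnitary 𝕜 c)) =
        ∑ J, ∑ I, ∑ J', ∑ I', ∫ z, f J I J' I' z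
          ∂((haarUnitary 𝕜 b).prod (haarUnitary 𝕜 c)) := by
      intro f hf
      rw [integral_finsetSum _ fun J _ => integrable_haarUnitary_prod (by fun_prop)]
      refine Finset.sum_congr rfl fun J _ => ?_
      rw [integral_finsetSum _ fun I _ => integrable_haarUnitary_prod (by fun_prop)]
      refine Finset.sum_congr rfl fun I _ => ?_
      rw [integral_finsetSum _ fun J' _ => integrable_haarUnitary_prod (by fun_prop)]
      refine Finset.sum_congr rfl fun J' _ => ?_
      rw [integral_finsetSum _ fun I' _ => integrable_haarUnitary_prod (by fun_prop)]
    rw [hsum _ fun J I J' I' => by fun_prop]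
    simp only [hmom, mul_ite, ite_mul, mul_zero, zero_mul, Finset.sum_ite_eq, Finset.mem_univ,
      if_true, Finset.sum_ite_irrel, Finset.sum_const_zero]
    rw [sumMinors_mul_conjTranspose, Finset.sum_comm, Finset.mul_sum]
    refine Finset.sum_congr rfl fun I _ => ?_
    rw [Finset.mul_sum]
    refine Finset.sum_congr rfl fun J _ => ?_
    rw [mul_inv]
    ring
  have hS (S : Fin k ↪o Fin a) (T : Fin k ↪o Fin e) : Integrable (fun z =>
      ((compression A (rowsColumns (𝕜 := 𝕜) hab hec z)).submatrix S T).det *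
        star ((compression A (rowsColumns (𝕜 := 𝕜) hab hec z)).submatrix S T).det)
        ((haarUnitary 𝕜 b).prod (haarUnitary 𝕜 c)) := by
    have h1 := (continuous_compression (𝕜 := 𝕜) A).comp (continuous_rowsColumns hab hec)
    have h2 := (h1.matrix_submatrix S T).matrix_det
    exact integrable_haarUnitary_prod (h2.mul h2.star)
  simp only [sumMinors_mul_conjTranspose k (compression A _)]
  rw [integral_finsetSum _ fun S _ => integrable_finsetSum _ fun T _ => hS S T]
  simp_rw [integral_finsetSum _ fun T _ => hS _ T, hterm, Finset.sum_const, Finset.card_univ,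
    card_orderEmbedding_fin, nsmul_eq_mul]
  ring

theorem integral_det_compression [NormedAlgebra 𝕜 𝕂] [StarModule 𝕜 𝕂]
    {d n ℓ : ℕ} (hℓ : ℓ ≤ d) (A : Matrix (Fin d) (Fin (d + n)) 𝕂)
    (x : 𝕂) :
    ∫ z, (Matrix.scalar (Fin ℓ) x -
        compression A (rowsColumns (𝕜 := 𝕜) hℓ (Nat.add_le_add_right hℓ n) z) *
        (compression A (rowsColumns (𝕜 := 𝕜) hℓ (Nat.add_le_add_right hℓ n) z))ᴴ).det
      ∂((haarUnitary 𝕜 d).prod (haarUnitary 𝕜 (d + n))) =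
    (((ℓ.factorial : 𝕂) * ((ℓ + n).factorial : 𝕂)) /
        ((d.factorial : 𝕂) * ((d + n).factorial : 𝕂))) *
      ((rectDerivative (n : 𝕂) ^ (d - ℓ)) (A * Aᴴ).charpoly).eval x := by
  rw [smul_rectDerivative_pow_charpoly hℓ]
  simp only [det_scalar_sub_eq_sum_sumMinors]
  have h1 := (continuous_compression (𝕜 := 𝕜) A).comp
    (continuous_rowsColumns hℓ (Nat.add_le_add_right hℓ n))
  rw [integral_finsetSum]
  · refine Finset.sum_congr rfl fun k _ => ?_
    rw [integral_mul_const, integral_const_mul, integral_sumMinors_compression]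
  · intro k _
    exact integrable_haarUnitary_prod ((continuous_const.mul
      ((continuous_sumMinors k).comp (h1.matrix_mul h1.matrix_conjTranspose))).mul continuous_const)

theorem map_rowsColumns_haarUnitary {a b c e : ℕ} (hab : a ≤ b) (hec : e ≤ c) :
    ((haarUnitary 𝕜 b).prod (haarUnitary 𝕜 c)).map (rowsColumns hab hec) =
      (uniformOrthonormalRows 𝕜 hab).prod (uniformOrthonormalColumns 𝕜 hec) := by
  have h1 : Measurable fun V : Matrix.unitaryGroup (Fin b) 𝕜 =>
      V.1.submatrix (Fin.castLE hab) id := by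
    apply Continuous.measurable
    fun_prop
  have h2 : Measurable fun V : Matrix.unitaryGroup (Fin c) 𝕜 =>
      V.1.submatrix id (Fin.castLE hec) := by
    apply Continuous.measurable
    fun_prop
  exact (Measure.map_prod_map _ _ h1 h2).symm

end Compression

end RectCompression

theorem mainTheorem12
    {𝕜 𝕂 : Type*} [RCLike 𝕜] [MeasurableSpace 𝕜] [BorelSpace 𝕜]
    [RCLike 𝕂] [NormedAlgebra 𝕜 𝕂] [StarModule 𝕜 𝕂]
    (d n ℓ : ℕ) (hℓ : ℓ < d) (A : Matrix (Fin d) (Fin (d + n)) 𝕂)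
    {Ω : Type*} [MeasurableSpace Ω] (P : Measure Ω) [IsProbabilityMeasure P]
    (U : Ω → Matrix (Fin ℓ) (Fin d) 𝕜) (O : Ω → Matrix (Fin (d + n)) (Fin (ℓ + n)) 𝕜)
    (hU : HasLaw U (RectCompression.uniformOrthonormalRows 𝕜 hℓ.le) P)
    (hO : HasLaw O
      (RectCompression.uniformOrthonormalColumns 𝕜 (Nat.add_le_add_right hℓ.le n)) P)
    (hUO : IndepFun U O P) :
    let C : Ω → Matrix (Fin ℓ) (Fin (ℓ + n)) 𝕂 := fun ω =>
      (U ω).map (algebraMap 𝕜 𝕂) * A * (O ω).map (algebraMap 𝕜 𝕂)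
    let p : 𝕂[X] := (A * Aᴴ).charpoly
    ∀ x : 𝕂,
      Integrable (fun ω => (Matrix.scalar (Fin ℓ) x - C ω * (C ω)ᴴ).det) P ∧
      ∫ ω, (Matrix.scalar (Fin ℓ) x - C ω * (C ω)ᴴ).det ∂P =
        (((ℓ.factorial : 𝕂) * ((ℓ + n).factorial : 𝕂)) /
            ((d.factorial : 𝕂) * ((d + n).factorial : 𝕂))) *
          ((RectCompression.rectDerivative (n : 𝕂) ^ (d - ℓ)) p).eval x := by
  intro C p x
  have hn : ℓ + n ≤ d + n := Nat.add_le_add_right hℓ.le n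
  let F (z : Matrix (Fin ℓ) (Fin d) 𝕜 × Matrix (Fin (d + n)) (Fin (ℓ + n)) 𝕜) : 𝕂 :=
    (Matrix.scalar (Fin ℓ) x - RectCompression.compression A z *
      (RectCompression.compression A z)ᴴ).det
  have hF : Continuous F := by
    have h := RectCompression.continuous_compression (𝕜 := 𝕜) (a := ℓ) (e := ℓ + n) A
    fun_prop
  have (a b : ℕ) : SecondCountableTopology (Matrix (Fin a) (Fin b) 𝕜) :=
    inferInstanceAs (SecondCountableTopology (Fin a → Fin b → 𝕜))
  have hr := RectCompression.continuous_rowsColumns (𝕜 := 𝕜) hℓ.le hn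
  -- Independence moves the problem to a product of compact groups, where continuity alone gives
  -- integrability.
  have hlaw : P.map (fun ω => (U ω, O ω)) =
      ((RectCompression.haarUnitary 𝕜 d).prod (RectCompression.haarUnitary 𝕜 (d + n))).map
        (RectCompression.rowsColumns hℓ.le hn) := by
    rw [RectCompression.map_rowsColumns_haarUnitary, hUO.map_prod_eq_prod_map_map hU.aemeasurable
      hO.aemeasurable, hU.map_eq, hO.map_eq]
  have hm : AEMeasurable (fun ω => (U ω, O ω)) P := hU.aemeasurable.prodMk hO.aemeasurable
  constructor
  · have h : Integrable F (P.map fun ω => (U ω, O ω)) := by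
      rw [hlaw, integrable_map_measure hF.aestronglyMeasurable hr.aemeasurable]
      exact RectCompression.integrable_haarUnitary_prod (hF.comp hr)
    exact h.comp_aemeasurable hm
  · refine (integral_map hm hF.aestronglyMeasurable).symm.trans ?_
    rw [hlaw, integral_map hr.aemeasurable hF.aestronglyMeasurable]
    exact RectCompression.integral_det_compression hℓ.le A x
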